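/- Let $G$ be a finite simple undirected graph of order $n$ that is unicyclic, i.e. connected and containing exactly one cycle, and let $k$ be the length of its unique cycle. Let $\lambda_1(G)\ge\cdots\ge\lambda_n(G)$ be the eigenvalues, with multiplicity, of the adjacency matrix of $G$, and put \[ s^+(G)=\sum_{\lambda_i(G)>0}\lambda_i(G)^2,\qquad s^-(G)=\sum_{\lambda_i(G)<0}\lambda_i(G)^2 . \] \begin{enumerate} \item[(i)] If $k\equiv 0\pmod 2$, then $s^+(G)=s^-(G)=n$. \item[(ii)] If $k\equiv 3\pmod 4$, then $s^+(G)>n>s^-(G)$. \item[(iii)] If $k\equiv 1\pmod 4$, then $s^+(G)<n<s^-(G)$. \end{enumerate} -/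

import Mathlib

namespace SimpleGraph

variable {V : Type*}

/-- A subgraph of `G` is a cycle if it is traced out by a cyclic walk. (All rotations and reversals
of such a walk trace out the same subgraph.) -/
def IsCycleSubgraph (G : SimpleGraph V) (C : G.Subgraph) : Prop :=
  ∃ (v : V) (c : G.Walk v v), c.IsCycle ∧ c.toSubgraph = C

/-- A graph is unicyclic if it is connected and contains exactly one cycle. -/
structure IsUnicyclic (G : SimpleGraph V) : Prop where
  connected : G.Connected
  existsUnique_cycle : ∃! C : G.Subgraph, G.IsCycleSubgraph C

variable [Fintype V] [DecidableEq V]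

/-- The adjacency eigenvalues of `G`, listed with multiplicity (indexed by the vertices). -/
noncomputable def adjEigenvalues (G : SimpleGraph V) [DecidableRel G.Adj] : V → ℝ :=
  (G.isHermitian_adjMatrix ℝ).eigenvalues

/-- `s⁺(G)`: the sum of the squares of the positive adjacency eigenvalues. -/
noncomputable def posSquareEnergy (G : SimpleGraph V) [DecidableRel G.Adj] : ℝ :=
  ∑ i with 0 < G.adjEigenvalues i, G.adjEigenvalues i ^ 2

/-- `s⁻(G)`: the sum of the squares of the negative adjacency eigenvalues. -/
noncomputable def negSquareEnergy (G : SimpleGraph V) [DecidableRel G.Adj] : ℝ :=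
  ∑ i with G.adjEigenvalues i < 0, G.adjEigenvalues i ^ 2

end SimpleGraph

/-! A connected unicyclic graph has `n` edges, so `s⁺ + s⁻ = 2n`, and only the sign of `s⁺ - s⁻ = ∑
λ|λ|` is at stake. An even cycle makes `G` bipartite, its spectrum symmetric and this sum zero.

For odd `k`, put `F(s) = ∑ (s⁻² + λ²) arctan(sλ)`. Since `∑ λ = 0`, `F' = -2s⁻³ ∑ arctan(sλ)`, while
`F` tends to `0` at `0⁺` and to `(π/2) ∑ λ|λ|` at infinity. The sum of arctangents is the continuous
argument of `∏ (1 + isλ) = det(1 + isA)`, so it is enough to find the quadrant of this determinant.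

Delete an edge `uv` of the cycle, leaving a tree in which `d = dist u v = k - 1` is even.
Conjugation by `diag(i ^ dist u x)` turns the tree part of `1 + isA` into a real matrix `X = 1 + sM`
with `M` skew, and the deleted edge into a symmetric rank-two term with coefficient `i^d s i`. With
`R = X⁻¹` and `R u v = R v u`, the determinant is `det X * (1 + s²(R u u * R v v - (R u v)²) + 2 i^d
s i * R u v)`. Positivity of the quadratic form of `R` makes the real part positive; a recursion
along the tree gives `R u v > 0`. So the sign of the imaginary part is `i^d = ±1`. -/

open Filter Topology

/-! ### Arctangent sums and a Coulson-type criterion -/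

/-- The polar form of `1 + x i`. -/
theorem Complex.one_add_ofReal_mul_I_eq (x : ℝ) :
    (1 + x * Complex.I : ℂ) = (√(1 + x ^ 2) : ℝ) * Complex.exp (Real.arctan x * Complex.I) := by
  have h : √(1 + x ^ 2) ≠ 0 := by positivity
  rw [Complex.exp_mul_I, ← Complex.ofReal_cos, ← Complex.ofReal_sin, Real.cos_arctan,
    Real.sin_arctan]
  apply Complex.ext <;> simp <;> field_simp

theorem Complex.exists_prod_one_add_mul_I_eq {ι : Type*} [Fintype ι] (x : ι → ℝ) :
    ∃ r : ℝ, 0 < r ∧ ∏ i, (1 + x i * Complex.I : ℂ) =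
      r * Complex.exp ((∑ i, Real.arctan (x i) : ℝ) * Complex.I) := by
  refine ⟨∏ i, √(1 + x i ^ 2), Finset.prod_pos fun i _ => by positivity, ?_⟩
  simp_rw [Complex.one_add_ofReal_mul_I_eq]
  rw [Finset.prod_mul_distrib, ← Complex.exp_sum]
  push_cast
  rw [Finset.sum_mul]

/-- If all the products `∏ (1 + s aᵢ i)` lie in the open first quadrant, then so does the
continuous branch of their argument. -/
theorem sum_arctan_pos {ι : Type*} [Fintype ι] (a : ι → ℝ)
    (h : ∀ s : ℝ, 0 < s → 0 < (∏ i, (1 + (s * a i : ℝ) * Complex.I : ℂ)).re ∧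
      0 < (∏ i, (1 + (s * a i : ℝ) * Complex.I : ℂ)).im) {s : ℝ} (hs : 0 < s) :
    0 < ∑ i, Real.arctan (s * a i) := by
  set g : ℝ → ℝ := fun s => ∑ i, Real.arctan (s * a i) with hg
  have hcont : Continuous g := by
    refine continuous_finsetSum _ fun i _ => ?_
    exact Real.continuous_arctan.comp (by fun_prop)
  have hg0 : g 0 = 0 := by simp [hg]
  have hcs : ∀ s, 0 < s → 0 < Real.cos (g s) ∧ 0 < Real.sin (g s) := by
    intro s hs
    obtain ⟨r, hr, he⟩ := Complex.exists_prod_one_add_mul_I_eq (fun i => s * a i)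
    have := h s hs
    rw [he, Complex.re_ofReal_mul, Complex.im_ofReal_mul, Complex.exp_ofReal_mul_I_re,
      Complex.exp_ofReal_mul_I_im] at this
    exact ⟨pos_of_mul_pos_right this.1 hr.le, pos_of_mul_pos_right this.2 hr.le⟩
  -- Since `g 0 = 0` and `cos ∘ g` has no zero on `[0, ∞)`, continuity traps `g` in `(-π/2, π/2)`,
  -- where the sign of `sin` is the sign of `g`.
  have hcos : ∀ s, 0 ≤ s → Real.cos (g s) ≠ 0 := by
    intro s hs
    rcases hs.eq_or_lt with rfl | hs
    · simp [hg0]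
    · exact (hcs s hs).1.ne'
  have hlt : g s < Real.pi / 2 := by
    by_contra! hge
    obtain ⟨t, ht, hgt⟩ := intermediate_value_Icc hs.le hcont.continuousOn
      (show Real.pi / 2 ∈ Set.Icc (g 0) (g s) from ⟨by rw [hg0]; positivity, hge⟩)
    exact hcos t ht.1 (by rw [hgt, Real.cos_pi_div_two])
  have hgt : -(Real.pi / 2) < g s := by
    by_contra! hge
    obtain ⟨t, ht, hgt⟩ := intermediate_value_Icc' hs.le hcont.continuousOn
      (show -(Real.pi / 2) ∈ Set.Icc (g s) (g 0) from
        ⟨hge, by rw [hg0]; linarith [Real.pi_pos]⟩)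
    exact hcos t ht.1 (by rw [hgt, Real.cos_neg, Real.cos_pi_div_two])
  by_contra! hneg
  have := Real.sin_nonpos_of_nonpos_of_neg_pi_le hneg (by linarith [Real.pi_pos])
  exact absurd (hcs s hs).2 (not_lt.mpr this)

/-- The weight `s⁻² + a²` cancels the denominator `1 + (sa)²` of the arctangent's derivative,
leaving `a / s²`, which vanishes after summation when `∑ a = 0`. -/
theorem hasDerivAt_inv_sq_add_sq_mul_arctan (a : ℝ) {s : ℝ} (hs : 0 < s) :
    HasDerivAt (fun s : ℝ => ((s ^ 2)⁻¹ + a ^ 2) * Real.arctan (s * a))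
      (-2 / s ^ 3 * Real.arctan (s * a) + a / s ^ 2) s := by
  have h1 : HasDerivAt (fun s : ℝ => (s ^ 2)⁻¹ + a ^ 2) (-2 / s ^ 3) s := by
    refine (((hasDerivAt_pow 2 s).fun_inv (by positivity)).add_const (a ^ 2)).congr_deriv ?_
    norm_num
    field_simp
  have h2 : HasDerivAt (fun s : ℝ => Real.arctan (s * a)) (1 / (1 + (s * a) ^ 2) * a) s := by
    have := ((hasDerivAt_id s).mul_const a).arctan
    simpa using this
  refine (h1.fun_mul h2).congr_deriv ?_
  have : 1 + (s * a) ^ 2 ≠ 0 := by positivity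
  field_simp

theorem Real.arctan_sub_self_isLittleO :
    (fun x : ℝ => Real.arctan x - x) =o[𝓝 0] fun x : ℝ => x ^ 2 := by
  have key : ∀ x : ℝ, |Real.arctan x - x| ≤ |x| ^ 3 := by
    have hpos : ∀ x : ℝ, 0 ≤ x → |Real.arctan x - x| ≤ x ^ 3 := by
      intro x hx
      have h1 : MonotoneOn (fun x : ℝ => Real.arctan x - x + x ^ 3) (Set.Ici 0) := by
        have hd : ∀ y : ℝ, HasDerivAt (fun x : ℝ => Real.arctan x - x + x ^ 3)
            (1 / (1 + y ^ 2) - 1 + 3 * y ^ 2) y := fun y => by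
          simpa using
            ((Real.hasDerivAt_arctan y).fun_sub (hasDerivAt_id' y)).fun_add (hasDerivAt_pow 3 y)
        refine monotoneOn_of_deriv_nonneg (convex_Ici 0)
          (fun y _ => (hd y).continuousAt.continuousWithinAt)
          (fun y _ => (hd y).differentiableAt.differentiableWithinAt) fun y _ => ?_
        rw [(hd y).deriv]
        have : 1 / (1 + y ^ 2) - 1 + 3 * y ^ 2 = (2 * y ^ 2 + 3 * y ^ 4) / (1 + y ^ 2) := by
          field_simp; ring
        rw [this]; positivity
      have h2 : AntitoneOn (fun x : ℝ => Real.arctan x - x) (Set.Ici 0) := by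
        have hd : ∀ y : ℝ, HasDerivAt (fun x : ℝ => Real.arctan x - x)
            (1 / (1 + y ^ 2) - 1) y := fun y => by
          simpa using (Real.hasDerivAt_arctan y).fun_sub (hasDerivAt_id' y)
        refine antitoneOn_of_deriv_nonpos (convex_Ici 0)
          (fun y _ => (hd y).continuousAt.continuousWithinAt)
          (fun y _ => (hd y).differentiableAt.differentiableWithinAt) fun y _ => ?_
        rw [(hd y).deriv]
        have : 1 / (1 + y ^ 2) - 1 = -(y ^ 2 / (1 + y ^ 2)) := by
          field_simp; ring
        rw [this]
        exact neg_nonpos.mpr (by positivity)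
      have h1' := h1 (Set.mem_Ici.mpr le_rfl) (Set.mem_Ici.mpr hx) hx
      have h2' := h2 (Set.mem_Ici.mpr le_rfl) (Set.mem_Ici.mpr hx) hx
      simp at h1' h2'
      have := pow_nonneg hx 3
      rw [abs_le]
      constructor <;> linarith
    intro x
    rcases le_total 0 x with hx | hx
    · rw [abs_of_nonneg hx]; exact hpos x hx
    · have := hpos (-x) (by linarith)
      rw [Real.arctan_neg, ← abs_neg] at this
      rw [abs_of_nonpos hx]
      convert this using 2
      ring
  have hO : (fun x : ℝ => Real.arctan x - x) =O[𝓝 0] fun x : ℝ => x ^ 3 :=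
    Asymptotics.IsBigO.of_bound 1 (Eventually.of_forall fun x => by
      simpa using key x)
  exact hO.trans_isLittleO (Asymptotics.isLittleO_pow_pow (by norm_num))

/-- The subtracted `a / s` is the singular part at `0`; it too disappears from the sum when `∑ a =
0`. The remainder is small because `arctan x - x = o(x²)`. -/
theorem tendsto_mul_arctan_sub_nhdsGT_zero (a : ℝ) :
    Tendsto (fun s : ℝ => ((s ^ 2)⁻¹ + a ^ 2) * Real.arctan (s * a) - a / s) (𝓝[>] 0) (𝓝 0) := by
  have h1 : Tendsto (fun s : ℝ => a ^ 2 * Real.arctan (s * a)) (𝓝[>] 0) (𝓝 0) := by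
    have : Continuous (fun s : ℝ => a ^ 2 * Real.arctan (s * a)) :=
      continuous_const.mul (Real.continuous_arctan.comp (by fun_prop))
    simpa using (this.tendsto 0).mono_left nhdsWithin_le_nhds
  have h2 : Tendsto (fun s : ℝ => (Real.arctan (s * a) - s * a) / (s ^ 2)) (𝓝[>] 0) (𝓝 0) := by
    have ht : Tendsto (fun s : ℝ => s * a) (𝓝 0) (𝓝 0) := by
      simpa using (continuous_mul_const a).tendsto 0
    have h := Real.arctan_sub_self_isLittleO.comp_tendsto ht
    have h' : (fun s : ℝ => Real.arctan (s * a) - s * a) =o[𝓝 0] fun s : ℝ => s ^ 2 := by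
      refine h.trans_isBigO (Asymptotics.IsBigO.of_bound (a ^ 2) (Eventually.of_forall fun s => ?_))
      simp [mul_pow, mul_comm]
    exact h'.tendsto_div_nhds_zero.mono_left nhdsWithin_le_nhds
  have h3 := h1.add h2
  rw [add_zero] at h3
  refine h3.congr' ?_
  filter_upwards [self_mem_nhdsWithin] with s hs
  have : s ≠ 0 := (Set.mem_Ioi.mp hs).ne'
  field_simp
  ring

theorem tendsto_mul_arctan_atTop (a : ℝ) :
    Tendsto (fun s : ℝ => ((s ^ 2)⁻¹ + a ^ 2) * Real.arctan (s * a)) atTop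
      (𝓝 (Real.pi / 2 * (a * |a|))) := by
  have h1 : Tendsto (fun s : ℝ => (s ^ 2)⁻¹ + a ^ 2) atTop (𝓝 (0 + a ^ 2)) :=
    (tendsto_inv_atTop_zero.comp (tendsto_pow_atTop two_ne_zero)).add_const _
  rcases lt_trichotomy a 0 with ha | rfl | ha
  · have h2 : Tendsto (fun s : ℝ => Real.arctan (s * a)) atTop (𝓝 (-(Real.pi / 2))) :=
      (Real.tendsto_arctan_atBot.mono_right nhdsWithin_le_nhds).comp
        (tendsto_id.atTop_mul_const_of_neg ha)
    convert h1.mul h2 using 2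
    rw [abs_of_neg ha]; ring
  · simp
  · have h2 : Tendsto (fun s : ℝ => Real.arctan (s * a)) atTop (𝓝 (Real.pi / 2)) :=
      (Real.tendsto_arctan_atTop.mono_right nhdsWithin_le_nhds).comp
        (tendsto_id.atTop_mul_const ha)
    convert h1.mul h2 using 2
    rw [abs_of_pos ha]; ring

/-- A Coulson-type criterion: if the numbers `aᵢ` have sum zero and all the products
`∏ (1 + s aᵢ i)`, `s > 0`, lie in the open first quadrant, then `∑ aᵢ |aᵢ| < 0`. -/
theorem sum_mul_abs_neg_of_prod_re_im_pos {ι : Type*} [Fintype ι] (a : ι → ℝ)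
    (ha : ∑ i, a i = 0)
    (h : ∀ s : ℝ, 0 < s → 0 < (∏ i, (1 + (s * a i : ℝ) * Complex.I : ℂ)).re ∧
      0 < (∏ i, (1 + (s * a i : ℝ) * Complex.I : ℂ)).im) :
    ∑ i, a i * |a i| < 0 := by
  set F : ℝ → ℝ := fun s => ∑ i, ((s ^ 2)⁻¹ + a i ^ 2) * Real.arctan (s * a i) with hF
  have hd : ∀ s, 0 < s → HasDerivAt F (-2 / s ^ 3 * ∑ i, Real.arctan (s * a i)) s := by
    intro s hs
    refine (HasDerivAt.fun_sum fun i (_ : i ∈ Finset.univ) =>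
      hasDerivAt_inv_sq_add_sq_mul_arctan (a i) hs).congr_deriv ?_
    rw [Finset.sum_add_distrib, ← Finset.sum_div, ha, zero_div, add_zero, Finset.mul_sum]
  have hanti : StrictAntiOn F (Set.Ioi 0) := by
    refine strictAntiOn_of_deriv_neg (convex_Ioi 0)
      (fun s hs => (hd s hs).continuousAt.continuousWithinAt) fun s hs => ?_
    rw [interior_Ioi] at hs
    rw [(hd s hs).deriv]
    have hs' : (0 : ℝ) < s := hs
    have : -2 / s ^ 3 < 0 := div_neg_of_neg_of_pos (by norm_num) (by positivity)
    exact mul_neg_of_neg_of_pos this (sum_arctan_pos a h hs)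
  have h0 : Tendsto F (𝓝[>] 0) (𝓝 0) := by
    have := tendsto_finsetSum Finset.univ fun i _ => tendsto_mul_arctan_sub_nhdsGT_zero (a i)
    simp only [Finset.sum_sub_distrib, ← Finset.sum_div, ha, zero_div, sub_zero,
      Finset.sum_const_zero] at this
    exact this
  have hinf : Tendsto F atTop (𝓝 (Real.pi / 2 * ∑ i, a i * |a i|)) := by
    rw [Finset.mul_sum]
    exact tendsto_finsetSum Finset.univ fun i _ => tendsto_mul_arctan_atTop (a i)
  -- Limits preserve only weak inequalities; strictness is recovered from `F 2 < F 1`.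
  have h1 : F 1 ≤ 0 := by
    refine ge_of_tendsto h0 ?_
    filter_upwards [Ioo_mem_nhdsGT (zero_lt_one' ℝ)] with s hs
    exact (hanti hs.1 (Set.mem_Ioi.mpr one_pos) hs.2).le
  have h2 : Real.pi / 2 * ∑ i, a i * |a i| ≤ F 2 := by
    refine le_of_tendsto hinf ?_
    filter_upwards [eventually_gt_atTop 2] with s hs
    exact (hanti (Set.mem_Ioi.mpr two_pos) (Set.mem_Ioi.mpr (by linarith)) hs).le
  have h3 : F 2 < F 1 :=
    hanti (Set.mem_Ioi.mpr one_pos) (Set.mem_Ioi.mpr two_pos) one_lt_two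
  have h4 : Real.pi / 2 * ∑ i, a i * |a i| < 0 := by linarith
  exact (pos_iff_neg_of_mul_neg h4).mp (by positivity)

theorem sum_mul_abs_pos_of_prod_re_pos_im_neg {ι : Type*} [Fintype ι] (a : ι → ℝ)
    (ha : ∑ i, a i = 0)
    (h : ∀ s : ℝ, 0 < s → 0 < (∏ i, (1 + (s * a i : ℝ) * Complex.I : ℂ)).re ∧
      (∏ i, (1 + (s * a i : ℝ) * Complex.I : ℂ)).im < 0) :
    0 < ∑ i, a i * |a i| := by
  have := sum_mul_abs_neg_of_prod_re_im_pos (fun i => - a i) (by simp [ha]) fun s hs => by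
    have hconj : ∏ i, (1 + (s * -a i : ℝ) * Complex.I : ℂ) =
        (starRingEnd ℂ) (∏ i, (1 + (s * a i : ℝ) * Complex.I : ℂ)) := by
      simp [map_prod]
    rw [hconj, Complex.conj_re, Complex.conj_im]
    exact ⟨(h s hs).1, neg_pos.mpr (h s hs).2⟩
  simpa using this

/-! ### Skew-symmetric perturbations of the identity -/

namespace Matrix

variable {V : Type*} [Fintype V]

theorem dotProduct_mulVec_self_of_transpose_eq_neg {M : Matrix V V ℝ} (hM : Mᵀ = -M)
    (x : V → ℝ) : x ⬝ᵥ M *ᵥ x = 0 := by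
  have h := dotProduct_transpose_mulVec M x x
  rw [hM, neg_mulVec, dotProduct_neg] at h
  linarith

variable [DecidableEq V]

theorem dotProduct_one_add_smul_mulVec_self {M : Matrix V V ℝ} (hM : Mᵀ = -M) (s : ℝ)
    (x : V → ℝ) : x ⬝ᵥ (1 + s • M) *ᵥ x = x ⬝ᵥ x := by
  rw [add_mulVec, one_mulVec, smul_mulVec, dotProduct_add, dotProduct_smul,
    dotProduct_mulVec_self_of_transpose_eq_neg hM, smul_zero, add_zero]

theorem det_one_add_smul_ne_zero {M : Matrix V V ℝ} (hM : Mᵀ = -M) (s : ℝ) :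
    (1 + s • M).det ≠ 0 := by
  intro h
  obtain ⟨x, hx, hx0⟩ := exists_mulVec_eq_zero_iff.mpr h
  have := dotProduct_one_add_smul_mulVec_self hM s x
  rw [hx0, dotProduct_zero] at this
  exact hx (dotProduct_self_eq_zero.mp this.symm)

theorem det_one_add_smul_pos {M : Matrix V V ℝ} (hM : Mᵀ = -M) (s : ℝ) :
    0 < (1 + s • M).det := by
  have hc : Continuous fun s : ℝ => (1 + s • M).det := by fun_prop
  by_contra! h
  obtain ⟨t, ht⟩ := mem_range_of_exists_le_of_exists_ge hc ⟨s, h⟩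
    ⟨0, by simp⟩
  exact det_one_add_smul_ne_zero hM t ht

/-- The inverse of `1 + s M`, for `M` real skew-symmetric, has positive definite quadratic form. -/
theorem dotProduct_inv_mulVec_pos {M : Matrix V V ℝ} (hM : Mᵀ = -M) (s : ℝ) {x : V → ℝ}
    (hx : x ≠ 0) : 0 < x ⬝ᵥ (1 + s • M)⁻¹ *ᵥ x := by
  have hu : IsUnit (1 + s • M).det := (det_one_add_smul_ne_zero hM s).isUnit
  set y := (1 + s • M)⁻¹ *ᵥ x with hy
  have hxy : x = (1 + s • M) *ᵥ y := by
    rw [hy, mulVec_mulVec, mul_nonsing_inv _ hu, one_mulVec]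
  have hy0 : y ≠ 0 := by
    intro h
    rw [h, mulVec_zero] at hxy
    exact hx hxy
  have h1 : x ⬝ᵥ y = y ⬝ᵥ y := by
    rw [hxy, dotProduct_comm, dotProduct_one_add_smul_mulVec_self hM]
  rw [h1]
  exact lt_of_le_of_ne (Finset.sum_nonneg fun i _ => mul_self_nonneg (y i))
    fun h => hy0 (dotProduct_self_eq_zero.mp h.symm)

/-- Cauchy–Schwarz for the positive quadratic form of the inverse. The form sees only the sum of the
two off-diagonal entries, hence the hypothesis that they agree. -/
theorem sq_le_mul_of_inv_apply_comm {M : Matrix V V ℝ} (hM : Mᵀ = -M) (s : ℝ) {u v : V}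
    (huv : u ≠ v) (hsymm : (1 + s • M)⁻¹ v u = (1 + s • M)⁻¹ u v) :
    (1 + s • M)⁻¹ u v ^ 2 ≤ (1 + s • M)⁻¹ u u * (1 + s • M)⁻¹ v v := by
  set R := (1 + s • M)⁻¹ with hR
  have hq : ∀ p q : ℝ, (p • Pi.single u 1 + q • Pi.single v 1 : V → ℝ) ⬝ᵥ
      R *ᵥ (p • Pi.single u 1 + q • Pi.single v 1) =
      p ^ 2 * R u u + 2 * p * q * R u v + q ^ 2 * R v v := by
    intro p q
    simp only [mulVec_add, mulVec_smul, mulVec_single_one, add_dotProduct, smul_dotProduct,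
      single_one_dotProduct, dotProduct_add, dotProduct_smul, col_apply, smul_eq_mul]
    rw [hsymm]
    ring
  have hd : 0 < R v v := by
    have := dotProduct_inv_mulVec_pos hM s (x := (0 : ℝ) • Pi.single u 1 + (1 : ℝ) • Pi.single v 1)
      (by simp)
    rw [← hR, hq] at this
    simpa using this
  have h := dotProduct_inv_mulVec_pos hM s
    (x := R v v • Pi.single u 1 + (-R u v) • Pi.single v 1) (by
      intro h
      have := congrFun h u
      simp [huv] at this
      exact hd.ne' this)
  rw [← hR, hq] at h
  have : R v v * (R u u * R v v - R u v ^ 2) > 0 := by linarith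
  exact (sub_pos.mp (pos_of_mul_pos_right this hd.le)).le

/-- The perturbation factors through a two-dimensional space, so the matrix determinant lemma
reduces the computation to a `2 × 2` determinant. -/
theorem det_map_ofReal_add_smul_single {X : Matrix V V ℝ} (hX : X.det ≠ 0) (u v : V) (z : ℂ) :
    (X.map Complex.ofReal + z • (single u v 1 + single v u 1)).det =
      X.det * ((1 + z * X⁻¹ v u) * (1 + z * X⁻¹ u v) - z ^ 2 * (X⁻¹ u u * X⁻¹ v v)) := by
  have hdet : (X.map Complex.ofReal).det = X.det := (Complex.ofRealHom.map_det X).symm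
  have hinv : (X.map Complex.ofReal)⁻¹ = X⁻¹.map Complex.ofReal := by
    apply inv_eq_left_inv
    have h := congrArg (fun Y => Complex.ofRealHom.mapMatrix Y) (nonsing_inv_mul X hX.isUnit)
    rw [map_mul, map_one] at h
    exact h
  have hfac : z • (single u v 1 + single v u 1 : Matrix V V ℂ) =
      (of fun x j => if x = ![u, v] j then 1 else 0 : Matrix V (Fin 2) ℂ) *
        (of fun j x => if x = ![v, u] j then z else 0 : Matrix (Fin 2) V ℂ) := by
    ext x y
    rw [mul_apply, Fin.sum_univ_two, smul_apply, add_apply, single_apply, single_apply]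
    change _ = (if x = u then 1 else 0) * (if y = v then z else 0) +
      (if x = v then 1 else 0) * (if y = u then z else 0)
    simp only [smul_eq_mul, eq_comm (a := x), eq_comm (a := y), ite_and]
    split_ifs <;> ring
  have hentry : ∀ (Y : Matrix V V ℂ) (i j : Fin 2),
      ((of fun j x => if x = ![v, u] j then z else 0 : Matrix (Fin 2) V ℂ) * Y *
        (of fun x j => if x = ![u, v] j then 1 else 0 : Matrix V (Fin 2) ℂ)) i j =
      z * Y (![v, u] i) (![u, v] j) := by
    intro Y i j
    simp only [mul_apply, of_apply, ite_mul, zero_mul, mul_ite, mul_one, mul_zero,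
      Finset.sum_ite_eq', Finset.mem_univ, if_true]
  rw [hfac, det_add_mul _ _ (by rw [hdet]; simpa using hX), hdet, hinv, det_fin_two]
  congr 1
  simp only [add_apply, hentry, map_apply, one_apply_eq, cons_val_zero, cons_val_one,
    one_apply_ne zero_ne_one, one_apply_ne one_ne_zero]
  ring

end Matrix

/-! ### Trees, rooted skew matrices and the added edge -/

namespace SimpleGraph

variable {V : Type*} {G T : SimpleGraph V}

theorem IsTree.dist_eq_length_of_isPath (hT : T.IsTree) {u v : V} {p : T.Walk u v}
    (hp : p.IsPath) : T.dist u v = p.length := by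
  obtain ⟨q, hq, hql⟩ := hT.connected.exists_path_of_dist u v
  rw [← hql, (hT.existsUnique_path u v).unique hq hp]

/-- Two neighbours of `x` that are closer to the root `u` of a tree than `x` coincide. -/
theorem IsTree.eq_of_adj_of_dist_add_one (hT : T.IsTree) {u x p q : V} (hp : T.Adj p x)
    (hq : T.Adj q x) (hdp : T.dist u x = T.dist u p + 1) (hdq : T.dist u x = T.dist u q + 1) :
    p = q := by
  obtain ⟨P, hP, hPl⟩ := hT.connected.exists_path_of_dist u p
  obtain ⟨Q, hQ, hQl⟩ := hT.connected.exists_path_of_dist u q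
  have h1 : (P.concat hp).IsPath := Walk.isPath_of_length_eq_dist _ (by simp [hPl, hdp])
  have h2 : (Q.concat hq).IsPath := Walk.isPath_of_length_eq_dist _ (by simp [hQl, hdq])
  have h := congrArg Walk.penultimate ((hT.existsUnique_path u x).unique h1 h2)
  simpa using h

theorem IsTree.exists_adj_dist_add_one (hT : T.IsTree) {u x : V} (hx : x ≠ u) :
    ∃ p, T.Adj p x ∧ T.dist u x = T.dist u p + 1 := by
  obtain ⟨P, hP, hPl⟩ := hT.connected.exists_path_of_dist u x
  have hnil : ¬ P.Nil := fun h => hx h.eq.symm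
  refine ⟨P.penultimate, P.adj_penultimate hnil, ?_⟩
  have h1 : T.dist u P.penultimate ≤ P.dropLast.length := dist_le _
  have h2 : P.dropLast.length + 1 = P.length := Walk.length_dropLast_add_one hnil
  have h3 := hT.dist_eq_dist_add_one_of_adj u (P.adj_penultimate hnil)
  omega

/-- Deleting an edge of the cycle of a unicyclic graph leaves a tree, in which the rest of the
cycle is the path between the ends of the edge. -/
theorem IsUnicyclic.exists_isTree_deleteEdges (hG : G.IsUnicyclic) {v : V} {c : G.Walk v v}
    (hc : c.IsCycle) : ∃ u w : V, G.Adj u w ∧ (G.deleteEdges {s(u, w)}).IsTree ∧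
      (G.deleteEdges {s(u, w)}).dist u w + 1 = c.length := by
  cases c with
  | nil => exact absurd rfl hc.ne_nil
  | @cons _ w _ h p =>
    have hp := (Walk.cons_isCycle_iff p h).mp hc
    have hmem : s(v, w) ∈ (Walk.cons h p).edges := by simp
    have htree : (G.deleteEdges {s(v, w)}).IsTree := by
      refine ⟨hG.connected.connected_delete_edge_of_not_isBridge
        fun hb => hb.notMem_edges_of_isCycle hc hmem, fun x d hd => ?_⟩
      have hd' := hd.mapLe (deleteEdges_le (G := G) {s(v, w)})
      -- A cycle surviving the deletion would trace the same subgraph as `c`, hence contain the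
      -- deleted edge.
      have heq := hG.existsUnique_cycle.unique ⟨_, _, hd', rfl⟩ ⟨_, _, hc, rfl⟩
      have hmem' : s(v, w) ∈ (d.mapLe (deleteEdges_le (G := G) {s(v, w)})).edges := by
        rw [← Walk.mem_edges_toSubgraph, heq, Walk.mem_edges_toSubgraph]
        exact hmem
      rw [Walk.edges_mapLe_eq_edges] at hmem'
      have := d.edges_subset_edgeSet hmem'
      simp at this
    refine ⟨v, w, h, htree, ?_⟩
    have hq : ∀ e ∈ p.edges, e ∉ ({s(v, w)} : Set (Sym2 V)) := by
      rintro e he rfl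
      exact hp.2 he
    rw [dist_comm, htree.dist_eq_length_of_isPath (Walk.IsPath.toDeleteEdges G _ hp.1 hq)]
    simp

open Classical in
/-- The skew-symmetric adjacency matrix of a graph rooted at `u`: edges are oriented towards `u`. -/
noncomputable def rootedSkewMatrix (T : SimpleGraph V) (u : V) : Matrix V V ℝ :=
  Matrix.of fun x y => if T.Adj x y then (if T.dist u y = T.dist u x + 1 then -1 else 1) else 0

theorem IsTree.transpose_rootedSkewMatrix (hT : T.IsTree) (u : V) :
    (T.rootedSkewMatrix u).transpose = -T.rootedSkewMatrix u := by
  ext x y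
  simp only [rootedSkewMatrix, Matrix.transpose_apply, Matrix.of_apply, Matrix.neg_apply]
  by_cases h : T.Adj x y
  · have := hT.dist_eq_dist_add_one_of_adj u h
    rw [if_pos h, if_pos h.symm]
    split_ifs <;> first | omega | simp
  · rw [if_neg h, if_neg fun h' => h h'.symm, neg_zero]

variable [Fintype V]

open Classical in
-- Working up from the leaves, the left side at `x` equals `q * y x` with `q > 0`, where `q = 1 + s
-- ∑ s / q_c` over the children `c`. The equations then propagate positivity from the root down.
theorem IsTree.pos_of_rooted_recursion (hT : T.IsTree) {u : V} {s : ℝ} (hs : 0 < s) {y : V → ℝ}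
    (hroot : y u + s * ∑ c with T.Adj u c ∧ T.dist u c = T.dist u u + 1, y c = 1)
    (hstep : ∀ x p, T.Adj p x → T.dist u x = T.dist u p + 1 →
      y x + s * ∑ c with T.Adj x c ∧ T.dist u c = T.dist u x + 1, y c = s * y p) (x : V) :
    0 < y x := by
  obtain ⟨N, hN⟩ : ∃ N, ∀ x, T.dist u x ≤ N :=
    ⟨Finset.univ.sup (T.dist u), fun x => Finset.le_sup (Finset.mem_univ x)⟩
  have key : ∀ m x, N ≤ T.dist u x + m → ∃ q : ℝ, 0 < q ∧
      y x + s * ∑ c with T.Adj x c ∧ T.dist u c = T.dist u x + 1, y c = q * y x := by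
    intro m
    induction m with
    | zero =>
      intro x hx
      refine ⟨1, one_pos, ?_⟩
      rw [Finset.sum_eq_zero, mul_zero, add_zero, one_mul]
      intro c hc
      have := (Finset.mem_filter.mp hc).2.2
      have := hN c
      omega
    | succ m ih =>
      intro x hx
      have : ∀ c, T.Adj x c ∧ T.dist u c = T.dist u x + 1 → ∃ r : ℝ, 0 < r ∧ y c = r * y x := by
        rintro c ⟨hc, hd⟩
        obtain ⟨q, hq, he⟩ := ih c (by omega)
        rw [hstep c x hc hd] at he
        exact ⟨s / q, by positivity, by field_simp; linarith⟩
      choose! r hr hry using this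
      refine ⟨1 + s * ∑ c with T.Adj x c ∧ T.dist u c = T.dist u x + 1, r c, ?_, ?_⟩
      · have : 0 ≤ ∑ c with T.Adj x c ∧ T.dist u c = T.dist u x + 1, r c :=
          Finset.sum_nonneg fun c hc => (hr c (Finset.mem_filter.mp hc).2).le
        positivity
      · rw [Finset.sum_congr rfl fun c hc => hry c (Finset.mem_filter.mp hc).2, ← Finset.sum_mul]
        ring
  have main : ∀ m x, T.dist u x = m → 0 < y x := by
    intro m
    induction m with
    | zero =>
      intro x hx
      obtain rfl : u = x := (hT.connected.dist_eq_zero_iff).mp hx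
      obtain ⟨q, hq, he⟩ := key N u (by omega)
      rw [hroot] at he
      exact pos_of_mul_pos_right (he ▸ one_pos) hq.le
    | succ m ih =>
      intro x hx
      obtain ⟨p, hp, hd⟩ := hT.exists_adj_dist_add_one (u := u) (x := x) (by
        rintro rfl
        simp at hx)
      obtain ⟨q, hq, he⟩ := key N x (by omega)
      rw [hstep x p hp hd] at he
      have := ih p (by omega)
      exact pos_of_mul_pos_right (he ▸ mul_pos hs this) hq.le
  exact main _ x rfl

variable [DecidableEq V]

/-- Row `u` of `R * X = 1` is the rooted recursion: in column `x`, children of `x` enter with sign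
`+` and its parent with sign `-`. -/
theorem IsTree.inv_one_add_smul_rootedSkewMatrix_pos (hT : T.IsTree) (u : V) {s : ℝ} (hs : 0 < s)
    (x : V) : 0 < (1 + s • T.rootedSkewMatrix u)⁻¹ u x := by
  classical
  have hu : IsUnit (1 + s • T.rootedSkewMatrix u).det :=
    (Matrix.det_one_add_smul_ne_zero (hT.transpose_rootedSkewMatrix u) s).isUnit
  set R := (1 + s • T.rootedSkewMatrix u)⁻¹ with hR
  have hmul : ∀ x, R u x + s * ∑ z, R u z * T.rootedSkewMatrix u z x = (1 : Matrix V V ℝ) u x := by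
    intro x
    have := congrFun (congrFun (Matrix.nonsing_inv_mul _ hu) u) x
    rw [← this, mul_add, mul_one, Matrix.mul_smul, Matrix.add_apply, Matrix.smul_apply,
      Matrix.mul_apply, smul_eq_mul]
  have hsum : ∀ x, ∑ z, R u z * T.rootedSkewMatrix u z x =
      ∑ c with T.Adj x c ∧ T.dist u c = T.dist u x + 1, R u c -
        ∑ p with T.Adj p x ∧ T.dist u x = T.dist u p + 1, R u p := by
    intro x
    rw [Finset.sum_filter, Finset.sum_filter, ← Finset.sum_sub_distrib]
    refine Finset.sum_congr rfl fun z _ => ?_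
    simp only [rootedSkewMatrix, Matrix.of_apply]
    by_cases h : T.Adj z x
    · have := hT.dist_eq_dist_add_one_of_adj u h
      simp only [h, h.symm, true_and, if_true]
      split_ifs <;> first | omega | simp
    · have h' : ¬ T.Adj x z := fun h' => h h'.symm
      simp [h, h']
  refine hT.pos_of_rooted_recursion hs (y := R u) (u := u) ?_ ?_ x
  · have := hmul u
    rw [hsum, Matrix.one_apply_eq] at this
    rw [← this, Finset.sum_eq_zero (s := Finset.univ.filter fun p =>
      T.Adj p u ∧ T.dist u u = T.dist u p + 1), sub_zero]
    intro p hp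
    have := (Finset.mem_filter.mp hp).2.2
    simp at this
  · intro x p hp hd
    have hne : u ≠ x := by
      rintro rfl
      simp at hd
    have := hmul x
    rw [hsum, Matrix.one_apply_ne hne] at this
    have hf : (Finset.univ.filter fun p => T.Adj p x ∧ T.dist u x = T.dist u p + 1) = {p} := by
      ext q
      simp only [Finset.mem_filter, Finset.mem_univ, true_and, Finset.mem_singleton]
      refine ⟨fun h => hT.eq_of_adj_of_dist_add_one h.1 hp h.2 hd, ?_⟩
      rintro rfl
      exact ⟨hp, hd⟩
    rw [hf, Finset.sum_singleton] at this
    linarith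

/-- Tree edges change the parity of the distance to `u`, so conjugation by `E = diag((-1) ^ dist u
x)` negates the skew part and transposes `X`, hence also its inverse. -/
theorem IsTree.inv_one_add_smul_rootedSkewMatrix_comm (hT : T.IsTree) (u : V) (s : ℝ) {x : V}
    (hx : Even (T.dist u x)) :
    (1 + s • T.rootedSkewMatrix u)⁻¹ x u = (1 + s • T.rootedSkewMatrix u)⁻¹ u x := by
  set X := 1 + s • T.rootedSkewMatrix u with hX
  have hM := hT.transpose_rootedSkewMatrix u
  have hu : IsUnit X.det := (Matrix.det_one_add_smul_ne_zero hM s).isUnit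
  let E : Matrix V V ℝ := Matrix.diagonal fun x => (-1) ^ T.dist u x
  have hE : E * E = 1 := by
    simp [E, Matrix.diagonal_mul_diagonal, ← mul_pow]
  have hEX : E * X * E = X.transpose := by
    ext a b
    have hab := congrFun (congrFun hM a) b
    simp only [Matrix.transpose_apply, Matrix.neg_apply] at hab
    simp only [E, hX, Matrix.mul_diagonal, Matrix.diagonal_mul, Matrix.transpose_apply,
      Matrix.add_apply, Matrix.smul_apply, smul_eq_mul, hab]
    by_cases h : T.Adj a b
    · rw [Matrix.one_apply_ne h.ne, Matrix.one_apply_ne h.ne.symm]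
      have hsq : ∀ m : ℕ, (-1 : ℝ) ^ m * (-1) ^ m = 1 := fun m => by simp [← mul_pow]
      rcases hT.dist_eq_dist_add_one_of_adj u h with h' | h' <;> rw [h', pow_succ]
      · linear_combination (-(s * T.rootedSkewMatrix u a b)) * hsq (T.dist u b)
      · linear_combination (-(s * T.rootedSkewMatrix u a b)) * hsq (T.dist u a)
    · have : T.rootedSkewMatrix u a b = 0 := by simp [rootedSkewMatrix, h]
      rw [this]
      by_cases hab : a = b
      · subst hab
        simp [← mul_pow]
      · simp [Matrix.one_apply_ne hab, Matrix.one_apply_ne (Ne.symm hab)]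
  have hinv : X⁻¹.transpose = E * X⁻¹ * E := by
    rw [Matrix.transpose_nonsing_inv, ← hEX]
    apply Matrix.inv_eq_left_inv
    calc E * X⁻¹ * E * (E * X * E) = E * X⁻¹ * (E * E) * X * E := by noncomm_ring
      _ = E * (X⁻¹ * X) * E := by rw [hE]; noncomm_ring
      _ = 1 := by rw [Matrix.nonsing_inv_mul _ hu, mul_one, hE]
  have := congrFun (congrFun hinv u) x
  simpa [E, Matrix.mul_diagonal, Matrix.diagonal_mul, hx.neg_one_pow] using this

/-- If `G` is obtained from the tree `T` by joining two vertices at even distance, the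
determinant of `1 + s i A(G)` lies in the open right half-plane, and the sign of its imaginary part
is determined by the distance. -/
theorem IsTree.exists_det_one_add_smul_adjMatrix_eq [DecidableRel G.Adj] (hT : T.IsTree) {u v : V}
    (huv : u ≠ v) (hnadj : ¬ T.Adj u v)
    (hadj : ∀ x y, G.Adj x y ↔ T.Adj x y ∨ (x = u ∧ y = v) ∨ (x = v ∧ y = u))
    (heven : Even (T.dist u v)) {s : ℝ} (hs : 0 < s) :
    ∃ a b : ℝ, 0 < a ∧ 0 < b ∧ (1 + (s * Complex.I) • G.adjMatrix ℂ).det =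
      a + Complex.I ^ T.dist u v * b * Complex.I := by
  set X := 1 + s • T.rootedSkewMatrix u with hX
  have hM := hT.transpose_rootedSkewMatrix u
  obtain ⟨σ, hσ, hσ2⟩ : ∃ σ : ℝ, Complex.I ^ T.dist u v = σ ∧ σ ^ 2 = 1 := by
    obtain ⟨m, hm⟩ := heven
    refine ⟨(-1) ^ m, ?_, by rw [← pow_mul, mul_comm, pow_mul]; simp⟩
    rw [hm, ← two_mul, pow_mul, Complex.I_sq]
    simp
  have hσc : (σ : ℂ) ^ 2 = 1 := by exact_mod_cast hσ2
  let D : Matrix V V ℂ := Matrix.diagonal fun x => Complex.I ^ T.dist u x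
  -- Along a tree edge the phases differ by one factor `i`, which makes the entry `±s`. The entries
  -- at `uv` and `vu` become `σsi` and `σ⁻¹si`, equal because `σ² = 1`.
  have hconj : (1 + (s * Complex.I) • G.adjMatrix ℂ) * D =
      D * (X.map Complex.ofReal + ((σ * s : ℝ) * Complex.I) •
        (Matrix.single u v 1 + Matrix.single v u 1)) := by
    ext x y
    simp only [D, hX, Matrix.mul_diagonal, Matrix.diagonal_mul, Matrix.add_apply,
      Matrix.smul_apply, smul_eq_mul, Matrix.map_apply, adjMatrix_apply, Matrix.single_apply]
    by_cases hT' : T.Adj x y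
    · have h1 : ¬ (u = x ∧ v = y) := by rintro ⟨rfl, rfl⟩; exact hnadj hT'
      have h2 : ¬ (v = x ∧ u = y) := by rintro ⟨rfl, rfl⟩; exact hnadj hT'.symm
      rw [if_neg h1, if_neg h2, if_pos ((hadj x y).mpr (Or.inl hT')),
        Matrix.one_apply_ne hT'.ne, Matrix.one_apply_ne hT'.ne]
      simp only [rootedSkewMatrix, Matrix.of_apply, if_pos hT']
      rcases hT.dist_eq_dist_add_one_of_adj u hT' with h' | h'
      · rw [if_neg (by omega), h', pow_succ]
        push_cast
        ring
      · rw [if_pos h', h', pow_succ]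
        push_cast
        linear_combination (s * Complex.I ^ T.dist u x) * Complex.I_sq
    · simp only [rootedSkewMatrix, Matrix.of_apply, if_neg hT']
      by_cases hxy : x = y
      · subst hxy
        have h1 : ¬ (u = x ∧ v = x) := by rintro ⟨rfl, rfl⟩; exact huv rfl
        have h2 : ¬ (v = x ∧ u = x) := by rintro ⟨rfl, rfl⟩; exact huv rfl
        simp [h1, h2]
      · rw [Matrix.one_apply_ne hxy, Matrix.one_apply_ne hxy]
        by_cases h1 : u = x ∧ v = y
        · obtain ⟨rfl, rfl⟩ := h1
          rw [if_pos ((hadj u v).mpr (Or.inr (Or.inl ⟨rfl, rfl⟩))), hσ]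
          simp [huv, huv.symm]
          ring
        · by_cases h2 : v = x ∧ u = y
          · obtain ⟨rfl, rfl⟩ := h2
            rw [if_pos ((hadj v u).mpr (Or.inr (Or.inr ⟨rfl, rfl⟩))), hσ]
            simp [huv, huv.symm]
            linear_combination (-(s * Complex.I)) * hσc
          · have h3 : ¬ G.Adj x y := by
              rw [hadj]
              rintro (h | ⟨rfl, rfl⟩ | ⟨rfl, rfl⟩)
              · exact hT' h
              · exact h1 ⟨rfl, rfl⟩
              · exact h2 ⟨rfl, rfl⟩
            simp [h1, h2, h3]
  have hD : D.det ≠ 0 := by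
    simp [D, Matrix.det_diagonal, Finset.prod_ne_zero_iff]
  have hdet := congrArg Matrix.det hconj
  rw [Matrix.det_mul, Matrix.det_mul, mul_comm] at hdet
  have hcomm := hT.inv_one_add_smul_rootedSkewMatrix_comm u s heven
  rw [mul_left_cancel₀ hD hdet,
    Matrix.det_map_ofReal_add_smul_single (Matrix.det_one_add_smul_ne_zero hM s), hcomm, hσ]
  have hpos := hT.inv_one_add_smul_rootedSkewMatrix_pos u hs v
  have hle := Matrix.sq_le_mul_of_inv_apply_comm hM s huv hcomm
  have hXpos := Matrix.det_one_add_smul_pos hM s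
  rw [← hX] at hpos hle hXpos ⊢
  refine ⟨X.det * (1 + s ^ 2 * (X⁻¹ u u * X⁻¹ v v - X⁻¹ u v ^ 2)), X.det * (2 * s * X⁻¹ u v),
    mul_pos hXpos ?_, by positivity, ?_⟩
  · have := mul_nonneg (sq_nonneg s) (sub_nonneg.mpr hle)
    linarith
  · push_cast
    linear_combination (X.det * s ^ 2 * ((X⁻¹ u v : ℂ) ^ 2 - X⁻¹ u u * X⁻¹ v v)) *
      (σ ^ 2 * Complex.I_sq - hσc)

end SimpleGraph

/-! ### Adjacency spectrum and square energies -/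

namespace SimpleGraph

variable {V : Type*} [Fintype V] [DecidableEq V] (G : SimpleGraph V) [DecidableRel G.Adj]

theorem charpoly_adjMatrix_eq_prod :
    (G.adjMatrix ℝ).charpoly = ∏ i, (Polynomial.X - Polynomial.C (G.adjEigenvalues i)) :=
  (G.isHermitian_adjMatrix ℝ).charpoly_eq

/-- This is the characteristic polynomial evaluated at `i / s`, rescaled by `-si` in each row. -/
theorem det_one_add_smul_adjMatrix {s : ℝ} (hs : s ≠ 0) :
    (1 + (s * Complex.I) • G.adjMatrix ℂ).det =
      ∏ i, (1 + (s * G.adjEigenvalues i : ℝ) * Complex.I : ℂ) := by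
  have hsc : (s : ℂ) ≠ 0 := by exact_mod_cast hs
  have hz : -(s * Complex.I) * (Complex.I / s) = 1 := by
    field_simp
    rw [Complex.I_sq]
    ring
  have hmap : G.adjMatrix ℂ = (G.adjMatrix ℝ).map Complex.ofRealHom := by
    ext x y
    simp [adjMatrix_apply, apply_ite]
  have hchar : (Matrix.scalar V (Complex.I / s) - G.adjMatrix ℂ).det =
      ∏ i, (Complex.I / s - G.adjEigenvalues i) := by
    rw [← Matrix.eval_charpoly, hmap, Matrix.charpoly_map, charpoly_adjMatrix_eq_prod,
      Polynomial.map_prod, Polynomial.eval_prod]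
    simp
  have hfac : (1 + (s * Complex.I) • G.adjMatrix ℂ) =
      (-(s * Complex.I)) • (Matrix.scalar V (Complex.I / s) - G.adjMatrix ℂ) := by
    rw [smul_sub, neg_smul (s * Complex.I) (G.adjMatrix ℂ), sub_neg_eq_add, Matrix.scalar_apply,
      ← Matrix.smul_one_eq_diagonal, smul_smul, hz, one_smul]
  rw [hfac, Matrix.det_smul, hchar, ← Finset.card_univ, ← Finset.prod_const,
    ← Finset.prod_mul_distrib]
  refine Finset.prod_congr rfl fun i _ => ?_
  rw [mul_sub, hz]
  push_cast
  ring

theorem sum_adjEigenvalues : ∑ i, G.adjEigenvalues i = 0 := by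
  have := (G.isHermitian_adjMatrix ℝ).trace_eq_sum_eigenvalues
  rw [trace_adjMatrix] at this
  exact this.symm

theorem sum_adjEigenvalues_sq : ∑ i, G.adjEigenvalues i ^ 2 = 2 * G.edgeFinset.card := by
  have hA := G.isHermitian_adjMatrix ℝ
  have h1 : (G.adjMatrix ℝ * G.adjMatrix ℝ).trace = ∑ i, G.adjEigenvalues i ^ 2 := by
    conv_lhs => rw [hA.spectral_theorem]
    rw [← map_mul, Unitary.conjStarAlgAut_apply, Matrix.trace_mul_cycle, Unitary.coe_star_mul_self,
      one_mul, Matrix.diagonal_mul_diagonal, Matrix.trace_diagonal]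
    exact Finset.sum_congr rfl fun i _ => (sq _).symm
  have h2 : (G.adjMatrix ℝ * G.adjMatrix ℝ).trace = 2 * G.edgeFinset.card := by
    simp only [Matrix.trace, Matrix.diag_apply, adjMatrix_mul_self_apply_self]
    exact_mod_cast G.sum_degrees_eq_twice_card_edges
  rw [← h1, h2]

theorem posSquareEnergy_add_negSquareEnergy :
    G.posSquareEnergy + G.negSquareEnergy = 2 * G.edgeFinset.card := by
  rw [← sum_adjEigenvalues_sq, posSquareEnergy, negSquareEnergy, Finset.sum_filter,
    Finset.sum_filter, ← Finset.sum_add_distrib]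
  refine Finset.sum_congr rfl fun i _ => ?_
  rcases lt_trichotomy (G.adjEigenvalues i) 0 with h | h | h
  · simp [h, h.le]
  · simp [h]
  · simp [h, h.le]

theorem posSquareEnergy_sub_negSquareEnergy :
    G.posSquareEnergy - G.negSquareEnergy = ∑ i, G.adjEigenvalues i * |G.adjEigenvalues i| := by
  rw [posSquareEnergy, negSquareEnergy, Finset.sum_filter,
    Finset.sum_filter, ← Finset.sum_sub_distrib]
  refine Finset.sum_congr rfl fun i _ => ?_
  rcases lt_trichotomy (G.adjEigenvalues i) 0 with h | h | h
  · simp [h, h.le, abs_of_neg, sq]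
  · simp [h]
  · simp [h, h.le, abs_of_pos, sq]

/-- The spectrum of a bipartite graph is symmetric, so its two square energies agree. -/
theorem posSquareEnergy_eq_negSquareEnergy_of_sign (ε : V → ℝ) (hε : ∀ x, ε x * ε x = 1)
    (hadj : ∀ x y, G.Adj x y → ε x * ε y = -1) : G.posSquareEnergy = G.negSquareEnergy := by
  have hD : Matrix.diagonal ε * Matrix.diagonal ε = 1 := by
    simp [Matrix.diagonal_mul_diagonal, hε]
  have hconj : ∀ t : ℝ, Matrix.diagonal ε * (Matrix.scalar V t - G.adjMatrix ℝ) *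
      Matrix.diagonal ε = -(Matrix.scalar V (-t) - G.adjMatrix ℝ) := by
    intro t
    ext x y
    simp only [Matrix.mul_diagonal, Matrix.diagonal_mul, Matrix.sub_apply, Matrix.neg_apply,
      adjMatrix_apply, Matrix.scalar_apply, Matrix.diagonal_apply]
    by_cases hxy : x = y
    · subst hxy
      simp only [SimpleGraph.irrefl, if_true, if_false]
      linear_combination t * hε x
    · by_cases h : G.Adj x y
      · simp only [hxy, h, if_true, if_false]
        linear_combination -hadj x y h
      · simp [hxy, h]
  have hdet : ∀ t : ℝ, (Matrix.scalar V t - G.adjMatrix ℝ).det =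
      (-(Matrix.scalar V (-t) - G.adjMatrix ℝ)).det := by
    intro t
    have h1 : (Matrix.diagonal ε).det * (Matrix.diagonal ε).det = 1 := by
      rw [← Matrix.det_mul, hD, Matrix.det_one]
    rw [← hconj, Matrix.det_mul, Matrix.det_mul]
    linear_combination (-(Matrix.scalar V t - G.adjMatrix ℝ).det) * h1
  have hpoly : ∏ i, (Polynomial.X - Polynomial.C (G.adjEigenvalues i)) =
      ∏ i, (Polynomial.X - Polynomial.C (-G.adjEigenvalues i)) := by
    refine Polynomial.funext fun t => ?_
    rw [← charpoly_adjMatrix_eq_prod, Matrix.eval_charpoly, hdet, Matrix.det_neg,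
      ← Matrix.eval_charpoly, charpoly_adjMatrix_eq_prod, Polynomial.eval_prod,
      Polynomial.eval_prod, ← Finset.card_univ, ← Finset.prod_const, ← Finset.prod_mul_distrib]
    refine Finset.prod_congr rfl fun i _ => ?_
    simp
    ring
  have hroots := congrArg Polynomial.roots hpoly
  simp only [Finset.prod] at hroots
  rw [← Function.comp_def (fun x => Polynomial.X - Polynomial.C x) G.adjEigenvalues,
    ← Function.comp_def (fun x => Polynomial.X - Polynomial.C x) fun i => -G.adjEigenvalues i,
    ← Multiset.map_map, ← Multiset.map_map, Polynomial.roots_multiset_prod_X_sub_C,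
    Polynomial.roots_multiset_prod_X_sub_C] at hroots
  -- The multiset of eigenvalues is invariant under negation, so the odd function `x * |x|` sums to
  -- zero over it.
  have hsum := congrArg (fun m : Multiset ℝ => (m.map fun x => x * |x|).sum) hroots
  simp only [Multiset.map_map, Function.comp_def, abs_neg] at hsum
  change ∑ i, G.adjEigenvalues i * |G.adjEigenvalues i| =
    ∑ i, -G.adjEigenvalues i * |G.adjEigenvalues i| at hsum
  simp only [neg_mul, Finset.sum_neg_distrib] at hsum
  have := G.posSquareEnergy_sub_negSquareEnergy
  linarith

theorem IsTree.card_edgeFinset_of_deleteEdges {u w : V} (huw : G.Adj u w)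
    (hT : (G.deleteEdges {s(u, w)}).IsTree) : G.edgeFinset.card = Fintype.card V := by
  classical
  rw [← hT.card_edgeFinset]
  have h : (G.deleteEdges {s(u, w)}).edgeFinset = G.edgeFinset.erase s(u, w) := by
    ext e
    simp [and_comm]
  rw [h, Finset.card_erase_add_one (by simpa using huw)]

end SimpleGraph

/-! ### The three residue classes of the cycle length -/

open SimpleGraph in
theorem theorem1p2 {V : Type*} [Fintype V] [DecidableEq V]
    (G : SimpleGraph V) [DecidableRel G.Adj] (n k : ℕ)
    (hG : G.IsUnicyclic) (hn : Fintype.card V = n)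
    {v : V} (c : G.Walk v v) (hc : c.IsCycle) (hk : c.length = k) :
    (k ≡ 0 [MOD 2] → G.posSquareEnergy = n ∧ G.negSquareEnergy = n) ∧
    (k ≡ 3 [MOD 4] → G.posSquareEnergy > n ∧ n > G.negSquareEnergy) ∧
    (k ≡ 1 [MOD 4] → G.posSquareEnergy < n ∧ n < G.negSquareEnergy) := by
  obtain ⟨u, w, huw, hT, hd⟩ := hG.exists_isTree_deleteEdges hc
  have hcard := IsTree.card_edgeFinset_of_deleteEdges G huw hT
  have hadd := G.posSquareEnergy_add_negSquareEnergy
  rw [hcard, hn] at hadd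
  have hsub := G.posSquareEnergy_sub_negSquareEnergy
  set T := G.deleteEdges {s(u, w)} with hTdef
  have hadj : ∀ x y, G.Adj x y ↔ T.Adj x y ∨ (x = u ∧ y = w) ∨ (x = w ∧ y = u) := by
    intro x y
    simp only [hTdef, deleteEdges_adj, Set.mem_singleton_iff, Sym2.eq_iff]
    constructor
    · tauto
    · rintro (h | ⟨rfl, rfl⟩ | ⟨rfl, rfl⟩)
      exacts [h.1, huw, huw.symm]
  have hnadj : ¬ T.Adj u w := by simp [hTdef]
  have hdet : Even (T.dist u w) → ∀ s : ℝ, 0 < s → ∃ a b : ℝ, 0 < a ∧ 0 < b ∧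
      ∏ i, (1 + (s * G.adjEigenvalues i : ℝ) * Complex.I : ℂ) =
        a + Complex.I ^ T.dist u w * b * Complex.I := by
    intro he s hs
    rw [← G.det_one_add_smul_adjMatrix hs.ne']
    exact hT.exists_det_one_add_smul_adjMatrix_eq huw.ne hnadj hadj he hs
  have hpow : ∀ m r, T.dist u w = 4 * m + r → Complex.I ^ T.dist u w = Complex.I ^ r := by
    intro m r h
    rw [h, pow_add, pow_mul, Complex.I_pow_four, one_pow, one_mul]
  refine ⟨fun h => ?_, fun h => ?_, fun h => ?_⟩
  · have hodd : Odd (T.dist u w) := by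
      rw [Nat.odd_iff]
      unfold Nat.ModEq at h
      omega
    have := G.posSquareEnergy_eq_negSquareEnergy_of_sign (fun x => (-1) ^ T.dist u x)
      (fun x => by simp [← mul_pow]) (fun x y hxy => by
        rw [← pow_add]
        apply Odd.neg_one_pow
        rcases (hadj x y).mp hxy with h | ⟨rfl, rfl⟩ | ⟨rfl, rfl⟩
        · rcases hT.dist_eq_dist_add_one_of_adj u h with h | h <;> rw [h]
          · exact ⟨T.dist u y, by ring⟩
          · exact ⟨T.dist u x, by ring⟩
        · simpa using hodd
        · simpa using hodd)
    constructor <;> linarith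
  · unfold Nat.ModEq at h
    -- Here `dist u w = k - 1 ≡ 2` modulo `4`, so `i ^ dist = -1` and the determinant lies in the
    -- fourth quadrant.
    have hr : T.dist u w = 4 * (T.dist u w / 4) + 2 := by omega
    have := sum_mul_abs_pos_of_prod_re_pos_im_neg _ G.sum_adjEigenvalues fun s hs => by
      obtain ⟨a, b, ha, hb, he⟩ := hdet (by rw [Nat.even_iff]; omega) s hs
      rw [he, hpow _ _ hr, Complex.I_sq]
      simpa using And.intro ha hb
    constructor <;> linarith
  · unfold Nat.ModEq at h
    have hr : T.dist u w = 4 * (T.dist u w / 4) + 0 := by omega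
    have := sum_mul_abs_neg_of_prod_re_im_pos _ G.sum_adjEigenvalues fun s hs => by
      obtain ⟨a, b, ha, hb, he⟩ := hdet (by rw [Nat.even_iff]; omega) s hs
      rw [he, hpow _ _ hr, pow_zero]
      simpa using And.intro ha hb
    constructor <;> linarith
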